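/- Let $\Omega$ be a signature (a set of predicate and functional symbols of finite arities, constants being functional symbols of arity $0$) that contains a predicate symbol of arity at least $2$. Models of $\Omega$ are nonempty, and $\mathfrak A\sqsupseteq\mathfrak B$ means that $\mathfrak B$ is a submodel of $\mathfrak A$. Say that the $\sqsupseteq$-satisfiability is expressible in a language $L$ over $\Omega$ if there is a map $f$ from the sentences of $L$ to the sentences of $L$ such that, for every sentence $\varphi$ of $L$ and every model $\mathfrak A$ of $\Omega$, $$\mathfrak A\vDash f(\varphi)\iff \mathfrak B\vDash\varphi\text{ for some model }\mathfrak B\text{ with }\mathfrak A\sqsupseteq\mathfrak B.$$ Then the $\sqsupseteq$-satisfiability is expressible neither in the finitary first-order language $L_{\omega,\omega}$ (with equality) nor in the infinitary language $L_{\infty,\omega}$, which allows conjunctions and disjunctions of arbitrary sets of formulas and quantification over finitely many variables at a time. -/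

import Mathlib

universe u v w

namespace SubmodelSat

/-- A model of the signature `Ω`: a nonempty set with an interpretation of all symbols of `Ω`. -/
structure Model (Ω : FirstOrder.Language.{u, v}) : Type (max u v (w + 1)) where
  carrier : Type w
  [str : Ω.Structure carrier]
  [nonempty : Nonempty carrier]

attribute [instance] Model.str Model.nonempty

/-- The nonempty substructure `S` of the model `A`, with the induced interpretations, as a model. -/
def Model.ofSubstructure {Ω : FirstOrder.Language.{u, v}} (A : Model.{u, v, w} Ω)
    (S : Ω.Substructure A.carrier) (hS : Nonempty S) : Model.{u, v, w} Ω where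
  carrier := S
  nonempty := hS

/-- `A ⊒ B`: the model `A` contains `B` as a submodel. -/
def ContainsSubmodel {Ω : FirstOrder.Language.{u, v}} (A B : Model.{u, v, w} Ω) : Prop :=
  ∃ (S : Ω.Substructure A.carrier) (hS : Nonempty S), B = A.ofSubstructure S hS

/-- Formulas of the infinitary language `L_{∞,ω}` over the signature `Ω` whose free variables are
among `x_0, …, x_{n-1}`: conjunctions and disjunctions of arbitrary families (indexed by sets of the
same size as the carriers of models) are allowed, quantifiers bind one variable at a time.
The quantifiers applied to a formula in `n + 1` variables bind the last variable `x_n`. -/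
inductive InfFormula (Ω : FirstOrder.Language.{u, v}) : ℕ → Type (max u v (w + 1))
  | equal {n : ℕ} (s t : Ω.Term (Fin n)) : InfFormula Ω n
  | rel {n l : ℕ} (R : Ω.Relations l) (ts : Fin l → Ω.Term (Fin n)) : InfFormula Ω n
  | not {n : ℕ} (φ : InfFormula Ω n) : InfFormula Ω n
  | iAnd {n : ℕ} (ι : Type w) (φ : ι → InfFormula Ω n) : InfFormula Ω n
  | iOr {n : ℕ} (ι : Type w) (φ : ι → InfFormula Ω n) : InfFormula Ω n
  | all {n : ℕ} (φ : InfFormula Ω (n + 1)) : InfFormula Ω n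
  | ex {n : ℕ} (φ : InfFormula Ω (n + 1)) : InfFormula Ω n

/-- Satisfaction of an `L_{∞,ω}`-formula in a structure `M` under an assignment of its
free variables. -/
def InfFormula.Realize {Ω : FirstOrder.Language.{u, v}} {M : Type w} [Ω.Structure M] :
    {n : ℕ} → InfFormula.{u, v, w} Ω n → (Fin n → M) → Prop
  | _, .equal s t, a => s.realize a = t.realize a
  | _, .rel R ts, a => FirstOrder.Language.Structure.RelMap R (fun i => (ts i).realize a)
  | _, .not φ, a => ¬ φ.Realize a
  | _, .iAnd _ φ, a => ∀ i, (φ i).Realize a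
  | _, .iOr _ φ, a => ∃ i, (φ i).Realize a
  | _, .all φ, a => ∀ x : M, φ.Realize (Fin.snoc a x)
  | _, .ex φ, a => ∃ x : M, φ.Realize (Fin.snoc a x)

/-- Sentences of `L_{∞,ω}`. -/
abbrev InfSentence (Ω : FirstOrder.Language.{u, v}) : Type (max u v (w + 1)) := InfFormula.{u, v, w} Ω 0

/-- `A ⊨ φ` for an `L_{∞,ω}`-sentence `φ`. -/
def Model.SatInf {Ω : FirstOrder.Language.{u, v}} (A : Model.{u, v, w} Ω) (φ : InfSentence.{u, v, w} Ω) :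
    Prop :=
  φ.Realize (M := A.carrier) Fin.elim0

/-- `A ⊨ φ` for a sentence `φ` of the finitary first-order language `L_{ω,ω}`. -/
def Model.SatFO {Ω : FirstOrder.Language.{u, v}} (A : Model.{u, v, w} Ω) (φ : Ω.Sentence) : Prop :=
  φ.Realize A.carrier

/-- Let `Sent` be the sentences of a model-theoretic language over `Ω` with satisfaction relation
`Sat`, let `C` be a class of models of `Ω` and `R` a binary relation between models. The
`R`-satisfiability on `C` is expressible in this language if there is an operation `f` on sentences
such that `A ⊨ f φ` iff `B ⊨ φ` for some `B` in `C` with `A R B`, for all sentences `φ`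
and all `A` in `C`. -/
def SatisfiabilityExpressible {Ω : FirstOrder.Language.{u, v}} {Sent : Type*}
    (Sat : Model.{u, v, w} Ω → Sent → Prop)
    (C : Set (Model.{u, v, w} Ω)) (R : Model.{u, v, w} Ω → Model.{u, v, w} Ω → Prop) : Prop :=
  ∃ f : Sent → Sent, ∀ φ : Sent, ∀ A ∈ C, Sat A (f φ) ↔ ∃ B ∈ C, R A B ∧ Sat B φ

end SubmodelSat

namespace SubmodelSat

open FirstOrder FirstOrder.Language Filter

/-! In both cases two models satisfy the same sentences, yet only one has a submodel of some φ, so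
`f φ` cannot exist. Finitary: φ says that each element has a predecessor. The well-founded order ω +
1 has no such submodel; its ultrapower has an infinite descending chain, and Łoś's theorem transfers
sentences. Infinitary: φ is `allRanks` for ω₁. It holds in ω₁ and has only uncountable models
(`rankFormula_exclusive`). By back-and-forth (`SameOrder.realize_iff`) the countable order ℚ≥0 is
equivalent to ω₁ ×ₗ ℚ≥0, which contains a copy of ω₁. -/

/-- The structure on `M` in which every functional symbol takes the constant value `c` and every
predicate symbol of arity at least `2` says that `r` holds between its first two arguments. -/
@[reducible] def binaryStructure (Ω : FirstOrder.Language.{u, v}) {M : Type w} (r : M → M → Prop)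
    (c : M) : Ω.Structure M where
  funMap _ _ := c
  RelMap {l} _ x := ∃ h : 2 ≤ l, r (x ⟨0, by omega⟩) (x ⟨1, by omega⟩)

/-- The model given by `binaryStructure`. -/
def binaryModel (Ω : FirstOrder.Language.{u, v}) {M : Type w} (r : M → M → Prop)
    (c : M) : Model.{u, v, w} Ω :=
  @Model.mk Ω M (binaryStructure Ω r c) ⟨c⟩

/-- The submodel of `binaryModel Ω r c` on a set containing `c`. -/
def binarySubstructure (Ω : FirstOrder.Language.{u, v}) {M : Type w} (r : M → M → Prop)
    (c : M) (s : Set M) (hc : c ∈ s) : Ω.Substructure (binaryModel Ω r c).carrier where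
  carrier := s
  fun_mem _ _ _ := hc

/-- The binary relation on `M` obtained from a predicate symbol `R` by letting its first argument be
`y` and all the others be `x`. -/
def binRel {Ω : FirstOrder.Language.{u, v}} {l : ℕ} (R : Ω.Relations l) {M : Type w}
    [Ω.Structure M] (y x : M) : Prop :=
  Structure.RelMap R fun i : Fin l => if i.val = 0 then y else x

section

variable {Ω : FirstOrder.Language.{u, v}} {l : ℕ} (R : Ω.Relations l)

theorem binRel_binaryModel (hl : 2 ≤ l) {M : Type w} (r : M → M → Prop) (c y x : M) :
    binRel R (M := (binaryModel Ω r c).carrier) y x ↔ r y x := by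
  refine (exists_prop_of_true hl).trans ?_
  simp

theorem binRel_substructure {M : Type w} [Ω.Structure M] (S : Ω.Substructure M) (y x : S) :
    binRel R y x ↔ binRel R (y : M) (x : M) := by
  have : (fun i : Fin l => ((if i.val = 0 then y else x : S) : M)) =
      fun i => if i.val = 0 then (y : M) else x := by
    funext i; split_ifs <;> rfl
  rw [binRel, binRel, ← this]
  rfl

/-! ### The finitary language -/

/-- Every element has a predecessor. -/
def noMinimal : Ω.Sentence :=
  BoundedFormula.all (BoundedFormula.ex
    (R.boundedFormula fun i => if i.val = 0 then Term.var (Sum.inr 1) else Term.var (Sum.inr 0)))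

theorem satFO_noMinimal (A : Model.{u, v, w} Ω) :
    A.SatFO (noMinimal R) ↔ ∀ x : A.carrier, ∃ y : A.carrier, binRel R y x := by
  simp only [Model.SatFO, Sentence.Realize, Formula.Realize, noMinimal,
    BoundedFormula.realize_all, BoundedFormula.realize_ex, BoundedFormula.realize_rel, binRel]
  refine forall_congr' fun x => exists_congr fun y => iff_of_eq (congrArg _ (funext fun i => ?_))
  split_ifs <;> simp [Fin.snoc]

theorem exists_submodel_noMinimal_iff (A : Model.{u, v, w} Ω) :
    (∃ B ∈ (Set.univ : Set (Model.{u, v, w} Ω)), ContainsSubmodel A B ∧ B.SatFO (noMinimal R)) ↔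
      ∃ S : Ω.Substructure A.carrier, Nonempty S ∧ ∀ x ∈ S, ∃ y ∈ S, binRel R y x := by
  have key (S : Ω.Substructure A.carrier) (hS : Nonempty S) :
      (A.ofSubstructure S hS).SatFO (noMinimal R) ↔ ∀ x ∈ S, ∃ y ∈ S, binRel R y x := by
    rw [satFO_noMinimal]
    change (∀ x : S, ∃ y : S, binRel R y x) ↔ _
    simp [binRel_substructure]
  constructor
  · rintro ⟨_, -, ⟨S, hS, rfl⟩, h⟩
    exact ⟨S, hS, (key S hS).1 h⟩
  · rintro ⟨S, hS, h⟩
    exact ⟨_, trivial, ⟨S, hS, rfl⟩, (key S hS).2 h⟩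

/-- The ordinal `ω + 1` with its top element as the value of all functional symbols. -/
def omegaModel (Ω : FirstOrder.Language.{u, v}) : Model.{u, v, w} Ω :=
  binaryModel Ω (M := ULift.{w} ℕ∞) (fun y x => y.down < x.down) ⟨⊤⟩

/-- An ultrapower of `omegaModel` over `ℕ`. -/
noncomputable def omegaUltrapower (Ω : FirstOrder.Language.{u, v}) : Model.{u, v, w} Ω where
  carrier := ((hyperfilter ℕ : Ultrafilter ℕ) : Filter ℕ).Product
    fun _ : ℕ => (omegaModel.{u, v, w} Ω).carrier

theorem not_satisfiabilityExpressible_satFO {Ω : FirstOrder.Language.{u, v}} {l : ℕ}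
    (R : Ω.Relations l) (hl : 2 ≤ l) :
    ¬ SatisfiabilityExpressible (Model.SatFO (Ω := Ω))
      (Set.univ : Set (Model.{u, v, w} Ω)) ContainsSubmodel := by
  rintro ⟨f, hf⟩
  have hf := hf (noMinimal R)
  simp only [exists_submodel_noMinimal_iff R] at hf
  have hω : ¬ (omegaModel.{u, v, w} Ω).SatFO (f (noMinimal R)) := by
    rw [hf _ trivial]
    rintro ⟨S, ⟨x, hx⟩, h⟩
    have wf : WellFounded fun y x : ULift.{w} ℕ∞ => y.down < x.down :=
      InvImage.wf ULift.down wellFounded_lt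
    obtain ⟨m, hm, hmin⟩ := wf.has_min (SetLike.coe S) ⟨x, hx⟩
    obtain ⟨y, hy, hyr⟩ := h m hm
    exact hmin y hy ((binRel_binaryModel R hl
      (fun y x : ULift.{w} ℕ∞ => y.down < x.down) ⟨⊤⟩ y m).1 hyr)
  have hu : (omegaUltrapower.{u, v, w} Ω).SatFO (f (noMinimal R)) := by
    rw [hf _ trivial]
    let cls (g : ℕ → ULift.{w} ℕ∞) : (omegaUltrapower.{u, v, w} Ω).carrier := Quotient.mk _ g
    have hcls (g h : ℕ → ULift.{w} ℕ∞) (hgh : ∀ᶠ n in atTop, (g n).down < (h n).down) :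
        binRel R (cls g) (cls h) := by
      have e : (fun i : Fin l => if i.val = 0 then cls g else cls h) =
          fun i => cls (if i.val = 0 then g else h) := by
        funext i; split_ifs <;> rfl
      rw [binRel, e]
      refine (@relMap_quotient_mk' Ω _ _ (Ultraproduct.setoidPrestructure
        (fun _ : ℕ => (omegaModel.{u, v, w} Ω).carrier) (hyperfilter ℕ)) l R
        fun i => if i.val = 0 then g else h).2 ?_
      change ∀ᶠ n in (hyperfilter ℕ : Filter ℕ), Structure.RelMap R
        (M := (omegaModel.{u, v, w} Ω).carrier) fun i : Fin l => (if i.val = 0 then g else h) n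
      -- A nonprincipal ultrafilter on ℕ contains every cofinite set.
      have h1 : ∀ᶠ n in (hyperfilter ℕ : Filter ℕ), (g n).down < (h n).down :=
        Nat.hyperfilter_le_atTop hgh
      filter_upwards [h1] with n hn
      have h2 := (binRel_binaryModel (Ω := Ω) R hl
        (fun y x : ULift.{w} ℕ∞ => y.down < x.down) ⟨⊤⟩ (g n) (h n)).2 hn
      refine (iff_of_eq (congrArg _ (funext fun i => ?_))).1 h2
      exact (ite_apply (i.val = 0) g h n).symm
    let top : ℕ → ULift.{w} ℕ∞ := fun _ => ⟨⊤⟩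
    -- The classes of `n - k` descend as `k` grows; `top` is added because all functional symbols
    -- take that value.
    let d (k : ℕ) : ℕ → ULift.{w} ℕ∞ := fun n => ⟨((n - k : ℕ) : ℕ∞)⟩
    let S : Ω.Substructure (omegaUltrapower.{u, v, w} Ω).carrier :=
      { carrier := {x | x = cls top ∨ ∃ k, x = cls (d k)}
        fun_mem := by
          intro n F x _
          left
          obtain ⟨y, rfl⟩ : ∃ y : Fin n → ℕ → ULift.{w} ℕ∞, x = fun i => cls (y i) :=
            ⟨fun i => (x i).out, funext fun i => (Quotient.out_eq (x i)).symm⟩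
          exact Ultraproduct.funMap_cast (M := fun _ : ℕ => (omegaModel.{u, v, w} Ω).carrier) F y }
    refine ⟨S, ⟨⟨cls top, Or.inl rfl⟩⟩, ?_⟩
    rintro x (rfl | ⟨k, rfl⟩)
    · exact ⟨cls (d 0), Or.inr ⟨0, rfl⟩, hcls _ _ (Eventually.of_forall fun n =>
        ENat.natCast_lt_top _)⟩
    · refine ⟨cls (d (k + 1)), Or.inr ⟨k + 1, rfl⟩, hcls _ _ ?_⟩
      -- Truncated subtraction decreases strictly only for `n > k`.
      filter_upwards [eventually_gt_atTop k] with n hn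
      exact Nat.cast_lt.2 (by omega)
  have := (Ultraproduct.sentence_realize (u := hyperfilter ℕ)
    (M := fun _ : ℕ => (omegaModel.{u, v, w} Ω).carrier) (f (noMinimal R))).1 hu
  exact hω this.exists.choose_spec

/-! ### The infinitary language -/

/-- The last variable `x` is such that the elements `y` with `R y x` realize exactly the
formulas `rankFormula R b` with `b < a`. -/
noncomputable def rankFormula {W : Type w} [LinearOrder W] [WellFoundedLT W] (a : W) (n : ℕ) :
    InfFormula.{u, v, w} Ω (n + 1) :=
  .iAnd (ULift.{w} Bool) fun s =>
    bif s.down then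
      -- The `none` disjunct negates the relation, so the disjunction acts as an implication.
      .all (.iOr (Option (Set.Iio a)) fun b => match b with
        | none => .not (.rel R fun i =>
            if i.val = 0 then .var (Fin.last (n + 1)) else .var (Fin.last n).castSucc)
        | some b => rankFormula b.1 (n + 1))
    else
      -- The binary conjunction is written by De Morgan as a negated disjunction.
      .iAnd (Set.Iio a) fun b => .ex (.not (.iOr (ULift.{w} Bool) fun t =>
        bif t.down then
          .not (.rel R fun i =>
            if i.val = 0 then .var (Fin.last (n + 1)) else .var (Fin.last n).castSucc)
        else .not (rankFormula b.1 (n + 1))))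
termination_by (wellFounded_lt (α := W)).wrap a
decreasing_by all_goals exact b.2

theorem realize_rankFormula {W : Type w} [LinearOrder W] [WellFoundedLT W] (a : W) (n : ℕ)
    {M : Type w} [Ω.Structure M] (x : Fin (n + 1) → M) :
    (rankFormula R a n).Realize x ↔
      (∀ y, binRel R y (x (Fin.last n)) →
        ∃ b < a, (rankFormula R b (n + 1)).Realize (Fin.snoc x y : Fin (n + 2) → M)) ∧
      ∀ b < a, ∃ y, binRel R y (x (Fin.last n)) ∧
        (rankFormula R b (n + 1)).Realize (Fin.snoc x y : Fin (n + 2) → M) := by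
  have hrel (y : M) : InfFormula.Realize (Ω := Ω) (.rel R fun i : Fin l =>
      if i.val = 0 then .var (Fin.last (n + 1)) else .var (Fin.last n).castSucc)
      (Fin.snoc x y : Fin (n + 2) → M) ↔ binRel R y (x (Fin.last n)) := by
    simp only [InfFormula.Realize, binRel]
    refine iff_of_eq (congrArg _ (funext fun i => ?_))
    split_ifs
    · simp only [Term.realize_var, Fin.snoc_last]
    · simp only [Term.realize_var, Fin.snoc_castSucc]
  simp only [InfFormula.Realize] at hrel
  rw [rankFormula]
  simp only [InfFormula.Realize, ULift.forall, Bool.forall_bool, cond_true, cond_false,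
    Option.exists, ULift.exists, Bool.exists_bool, hrel, Subtype.exists, Subtype.forall,
    Set.mem_Iio, not_or, not_not, exists_prop]
  rw [and_comm]
  refine and_congr (forall_congr' fun y => imp_iff_not_or.symm) ?_
  exact forall₂_congr fun b _ => exists_congr fun y => and_comm

/-- If `x` had ranks `b < a`, some predecessor would have rank `b` and also a rank below `b`:
descent. Nothing is assumed about `R`. -/
theorem rankFormula_exclusive {W : Type w} [LinearOrder W] [WellFoundedLT W]
    {M : Type w} [Ω.Structure M] (a : W) : ∀ (b : W) (n : ℕ) (x : Fin (n + 1) → M), b < a →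
      (rankFormula R a n).Realize x → ¬ (rankFormula R b n).Realize x := by
  induction a using WellFoundedLT.induction with
  | _ a ih =>
    intro b n x hba ha hb
    obtain ⟨y, hy, hby⟩ := ((realize_rankFormula R a n x).1 ha).2 b hba
    obtain ⟨b', hb', hby'⟩ := ((realize_rankFormula R b n x).1 hb).1 y hy
    exact ih b hba b' _ _ hb' hby hby'

/-- Every rank below the order type of `W` is attained. -/
noncomputable def allRanks (W : Type w) [LinearOrder W] [WellFoundedLT W] :
    InfSentence.{u, v, w} Ω :=
  .iAnd W fun a => .ex (rankFormula R a 0)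

theorem uncountable_of_satInf_allRanks {W : Type w} [LinearOrder W] [WellFoundedLT W]
    [Uncountable W] (A : Model.{u, v, w} Ω) (h : A.SatInf (allRanks R W)) :
    Uncountable A.carrier := by
  simp only [Model.SatInf, allRanks, InfFormula.Realize] at h
  choose g hg using h
  have hinj : Function.Injective g := by
    intro a b hab
    have ha := hg a
    rw [hab] at ha
    rcases lt_trichotomy a b with h | h | h
    · exact absurd ha (rankFormula_exclusive R b a _ _ h (hg b))
    · exact h
    · exact absurd (hg b) (rankFormula_exclusive R a b _ _ h ha)
  exact hinj.uncountable

theorem satInf_allRanks {W : Type w} [LinearOrder W] [WellFoundedLT W] (A : Model.{u, v, w} Ω)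
    (e : W → A.carrier) (he : Function.Surjective e) (hr : ∀ a b, binRel R (e a) (e b) ↔ a < b) :
    A.SatInf (allRanks R W) := by
  have key (a : W) : ∀ (n : ℕ) (x : Fin (n + 1) → A.carrier), x (Fin.last n) = e a →
      (rankFormula R a n).Realize x := by
    induction a using WellFoundedLT.induction with
    | _ a ih =>
      intro n x hx
      rw [realize_rankFormula, hx]
      constructor
      · intro y hy
        obtain ⟨b, rfl⟩ := he y
        have hb := (hr b a).1 hy
        exact ⟨b, hb, ih b hb _ _ (Fin.snoc_last _ _)⟩
      · intro b hb
        exact ⟨e b, (hr b a).2 hb, ih b hb _ _ (Fin.snoc_last _ _)⟩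
  simp only [Model.SatInf, allRanks, InfFormula.Realize]
  exact fun a => ⟨e a, key a _ _ (Fin.snoc_last (α := fun _ => A.carrier) _ _)⟩

end

/-! ### Back-and-forth between dense linear orders -/

section BackAndForth

variable {M N : Type w} [LinearOrder M] [OrderBot M] [LinearOrder N] [OrderBot N]

/-- The tuples `a` and `b`, extended by the least elements, are ordered in the same way. -/
def SameOrder {n : ℕ} (a : Fin n → M) (b : Fin n → N) : Prop :=
  ∀ i j : Option (Fin n), i.elim ⊥ a < j.elim ⊥ a ↔ i.elim ⊥ b < j.elim ⊥ b

theorem SameOrder.symm {n : ℕ} {a : Fin n → M} {b : Fin n → N} (h : SameOrder a b) :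
    SameOrder b a :=
  fun i j => (h i j).symm

theorem SameOrder.eq_iff {n : ℕ} {a : Fin n → M} {b : Fin n → N} (h : SameOrder a b)
    (i j : Option (Fin n)) : i.elim ⊥ a = j.elim ⊥ a ↔ i.elim ⊥ b = j.elim ⊥ b := by
  have h1 := h i j
  have h2 := h j i
  rw [← not_iff_not, ← ne_eq, ← ne_eq, lt_or_lt_iff_ne.symm, lt_or_lt_iff_ne.symm, h1, h2]

/-- A new `x` lies in a gap between finitely many points; density fills a bounded gap and
`NoMaxOrder` the top one. The point ⊥ rules out a gap below all points. -/
theorem exists_same_cut {M N : Type*} [LinearOrder M] [OrderBot M] [LinearOrder N] [DenselyOrdered N] [NoMaxOrder N] {ι : Type*} [Finite ι]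
    (a : ι → M) (b : ι → N) (hab : ∀ i j, a i < a j ↔ b i < b j)
    (i₀ : ι) (hi₀ : a i₀ = ⊥) (x : M) :
    ∃ y : N, ∀ i, (a i < x ↔ b i < y) ∧ (x < a i ↔ y < b i) := by
  classical
  by_cases hx : ∃ k, a k = x
  · obtain ⟨k, rfl⟩ := hx
    exact ⟨b k, fun i => ⟨hab i k, hab k i⟩⟩
  have hne : ∀ i, a i ≠ x := fun i hi => hx ⟨i, hi⟩
  obtain ⟨p, hp, hpmax⟩ := Set.exists_max_image {i | a i < x} b (Set.toFinite _)
    ⟨i₀, lt_of_le_of_ne (hi₀ ▸ bot_le) (hne i₀)⟩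
  have fin (y : N) (h1 : b p < y) (h2 : ∀ i, x < a i → y < b i) :
      ∃ y : N, ∀ i, (a i < x ↔ b i < y) ∧ (x < a i ↔ y < b i) := by
    refine ⟨y, fun i => ?_⟩
    rcases lt_or_gt_of_ne (hne i) with h | h
    · have h3 : b i < y := (hpmax i h).trans_lt h1
      simp [h, h3, h.not_gt, h3.not_gt]
    · have h3 := h2 i h
      simp [h, h3, h.not_gt, h3.not_gt]
  by_cases hgt : ∃ i, x < a i
  · obtain ⟨q, hq, hqmin⟩ := Set.exists_min_image {i | x < a i} b (Set.toFinite _) hgt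
    obtain ⟨y, hy1, hy2⟩ := exists_between ((hab p q).1 (lt_trans hp hq))
    exact fin y hy1 fun i hi => hy2.trans_le (hqmin i hi)
  · obtain ⟨y, hy⟩ := exists_gt (b p)
    exact fin y hy fun i hi => absurd ⟨i, hi⟩ hgt

theorem SameOrder.exists_snoc [DenselyOrdered N] [NoMaxOrder N] {n : ℕ} {a : Fin n → M}
    {b : Fin n → N} (h : SameOrder a b) (x : M) :
    ∃ y : N, SameOrder (Fin.snoc a x : Fin (n + 1) → M) (Fin.snoc b y : Fin (n + 1) → N) := by
  obtain ⟨y, hy⟩ := exists_same_cut (fun i : Option (Fin n) => i.elim ⊥ a) (fun i => i.elim ⊥ b)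
    h none rfl x
  refine ⟨y, ?_⟩
  have cases (i : Option (Fin (n + 1))) :
      (i.elim ⊥ (Fin.snoc a x : Fin (n + 1) → M) = x ∧
        i.elim ⊥ (Fin.snoc b y : Fin (n + 1) → N) = y) ∨
      ∃ k : Option (Fin n), i.elim ⊥ (Fin.snoc a x : Fin (n + 1) → M) = k.elim ⊥ a ∧
        i.elim ⊥ (Fin.snoc b y : Fin (n + 1) → N) = k.elim ⊥ b := by
    rcases i with _ | i
    · exact Or.inr ⟨none, rfl, rfl⟩
    · induction i using Fin.lastCases with
      | last => left; simp
      | cast i => right; exact ⟨some i, by simp, by simp⟩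
  intro i j
  rcases cases i with ⟨h1, h2⟩ | ⟨k, h1, h2⟩ <;> rcases cases j with ⟨h3, h4⟩ | ⟨m, h3, h4⟩ <;>
    rw [h1, h2, h3, h4]
  · simp
  · exact (hy m).2
  · exact (hy k).1
  · exact h k m

/-- The model given by a linear order, with the least element as the value of all functional
symbols. -/
abbrev orderModel (Ω : FirstOrder.Language.{u, v}) (M : Type w) [LinearOrder M] [OrderBot M] :
    Model.{u, v, w} Ω :=
  binaryModel Ω (M := M) (· < ·) ⊥

variable {Ω : FirstOrder.Language.{u, v}}

/-- Any functional symbol returns ⊥, so a term is a variable or ⊥, uniformly in the order. Hence ⊥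
is included in `SameOrder`. -/
theorem realize_term_orderModel {n : ℕ} (t : Ω.Term (Fin n)) :
    ∃ i : Option (Fin n), ∀ (M : Type w) [LinearOrder M] [OrderBot M] (a : Fin n → M),
      t.realize (M := (orderModel Ω M).carrier) a = i.elim ⊥ a := by
  cases t with
  | var i => exact ⟨some i, fun _ _ _ _ => rfl⟩
  | func f ts => exact ⟨none, fun _ _ _ _ => rfl⟩

theorem SameOrder.realize_iff [DenselyOrdered M] [NoMaxOrder M] [DenselyOrdered N] [NoMaxOrder N]
    {n : ℕ} (φ : InfFormula.{u, v, w} Ω n) (a : Fin n → M) (b : Fin n → N) (h : SameOrder a b) :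
    φ.Realize (M := (orderModel Ω M).carrier) a ↔
      φ.Realize (M := (orderModel Ω N).carrier) b := by
  induction φ with
  | equal s t =>
    obtain ⟨i, hi⟩ := realize_term_orderModel.{u, v, w} s
    obtain ⟨j, hj⟩ := realize_term_orderModel.{u, v, w} t
    exact (iff_of_eq (congrArg₂ Eq (hi M a) (hj M a))).trans
      ((h.eq_iff i j).trans (iff_of_eq (congrArg₂ Eq (hi N b) (hj N b)).symm))
  | @rel n l R ts =>
    -- For arity below 2 both sides are false.
    refine exists_congr fun hl => ?_
    obtain ⟨i, hi⟩ := realize_term_orderModel.{u, v, w} (ts ⟨0, by omega⟩)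
    obtain ⟨j, hj⟩ := realize_term_orderModel.{u, v, w} (ts ⟨1, by omega⟩)
    exact (iff_of_eq (congrArg₂ (LT.lt (α := M)) (hi M a) (hj M a))).trans
      ((h i j).trans (iff_of_eq (congrArg₂ (LT.lt (α := N)) (hi N b) (hj N b)).symm))
  | not φ ih => exact not_congr (ih a b h)
  | iAnd ι φ ih => exact forall_congr' fun i => ih i a b h
  | iOr ι φ ih => exact exists_congr fun i => ih i a b h
  | all φ ih =>
    constructor
    · intro H y
      obtain ⟨x, hx⟩ := h.symm.exists_snoc y
      exact (ih _ _ hx.symm).1 (H x)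
    · intro H x
      obtain ⟨y, hy⟩ := h.exists_snoc x
      exact (ih _ _ hy).2 (H y)
  | ex φ ih =>
    constructor
    · rintro ⟨x, H⟩
      obtain ⟨y, hy⟩ := h.exists_snoc x
      exact ⟨y, (ih _ _ hy).1 H⟩
    · rintro ⟨y, H⟩
      obtain ⟨x, hx⟩ := h.symm.exists_snoc y
      exact ⟨x, (ih _ _ hx.symm).2 H⟩

/-- Dense linear orders with a least and without a greatest element satisfy the same
`L_{∞,ω}`-sentences. -/
theorem satInf_orderModel_iff [DenselyOrdered M] [NoMaxOrder M] [DenselyOrdered N] [NoMaxOrder N]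
    (φ : InfSentence.{u, v, w} Ω) :
    (orderModel Ω M).SatInf φ ↔ (orderModel Ω N).SatInf φ := by
  refine SameOrder.realize_iff (M := M) (N := N) φ _ _ ?_
  rintro (_ | i) (_ | j)
  · simp
  · exact j.elim0
  · exact i.elim0
  · exact i.elim0

end BackAndForth

theorem not_satisfiabilityExpressible_satInf {Ω : FirstOrder.Language.{u, v}} {l : ℕ}
    (R : Ω.Relations l) (hl : 2 ≤ l) :
    ¬ SatisfiabilityExpressible (Model.SatInf (Ω := Ω))
      (Set.univ : Set (Model.{u, v, w} Ω)) ContainsSubmodel := by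
  rintro ⟨f, hf⟩
  let W : Type w := (Cardinal.aleph.{w} 1).ord.ToType
  have : Uncountable W := by
    rw [← Cardinal.aleph0_lt_mk_iff, Cardinal.mk_ord_toType]
    exact Cardinal.aleph0_lt_aleph_one
  have : Nonempty W := inferInstance
  let : OrderBot W := WellFoundedLT.toOrderBot W
  have hf := hf (allRanks R W)
  -- The factor `PUnit` only moves ℚ≥0 to the universe `w`.
  have hQ : ¬ (orderModel Ω (PUnit.{w + 1} ×ₗ ℚ≥0)).SatInf (f (allRanks R W)) := by
    rw [hf _ trivial]
    rintro ⟨_, -, ⟨S, hS, rfl⟩, h⟩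
    have hunc : Uncountable S := uncountable_of_satInf_allRanks R _ h
    have hc : Countable (PUnit.{w + 1} ×ₗ ℚ≥0) := inferInstanceAs (Countable (PUnit × ℚ≥0))
    have : Countable S := Subtype.countable (α := PUnit.{w + 1} ×ₗ ℚ≥0)
    exact not_countable (α := S) this
  have hW : (orderModel Ω (W ×ₗ ℚ≥0)).SatInf (f (allRanks R W)) := by
    rw [hf _ trivial]
    let e (a : W) : W ×ₗ ℚ≥0 := toLex (a, 0)
    -- The copy of `W` contains ⊥ = (⊥, 0), so it is closed under the functional symbols.
    let S := binarySubstructure Ω (M := W ×ₗ ℚ≥0) (· < ·) ⊥ (Set.range e) ⟨⊥, rfl⟩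
    have hS : Nonempty S := ⟨⟨e ⊥, ⊥, rfl⟩⟩
    refine ⟨_, trivial, ⟨S, hS, rfl⟩,
      satInf_allRanks R _ (fun a => (⟨e a, a, rfl⟩ : S)) ?_ fun a b => ?_⟩
    · rintro ⟨_, a, rfl⟩
      exact ⟨a, rfl⟩
    · refine (binRel_substructure R S _ _).trans ((binRel_binaryModel R hl _ _ _ _).trans ?_)
      simp [e, Prod.Lex.toLex_lt_toLex]
  exact hQ ((satInf_orderModel_iff _).1 hW)

end SubmodelSat

theorem mainTheorem8 (Ω : FirstOrder.Language.{u, v}) (hΩ : ∃ n : ℕ, 2 ≤ n ∧ Nonempty (Ω.Relations n)) :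
    ¬ SubmodelSat.SatisfiabilityExpressible (SubmodelSat.Model.SatFO (Ω := Ω))
        (Set.univ : Set (SubmodelSat.Model.{u, v, w} Ω)) SubmodelSat.ContainsSubmodel ∧
    ¬ SubmodelSat.SatisfiabilityExpressible (SubmodelSat.Model.SatInf (Ω := Ω))
        (Set.univ : Set (SubmodelSat.Model.{u, v, w} Ω)) SubmodelSat.ContainsSubmodel := by
  obtain ⟨n, hn, ⟨R⟩⟩ := hΩ
  exact ⟨SubmodelSat.not_satisfiabilityExpressible_satFO R hn,
    SubmodelSat.not_satisfiabilityExpressible_satInf R hn⟩
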